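/- Let $Y$ be a computable Polish space, i.e. a complete metric space $(Y,d)$ with a distinguished dense sequence $(s_i)_{i\in\mathbb N}$ such that the reals $d(s_i,s_j)$ are computable uniformly in $i,j$. A computable sequence of c.e. open sets is a sequence $(U_n)_{n\in\mathbb N}$ of subsets of $Y$ for which there is a c.e. set $W$ of tuples $(n,i,r)$, with $n,i\in\mathbb N$ and $r$ a positive rational, such that $U_n=\bigcup\{B(s_i,r):(n,i,r)\in W\}$ for every $n$, where $B(s_i,r)$ is the open ball with centre $s_i$ and radius $r$; a computable sequence of effectively closed sets is a sequence $(C_n)$ such that $(Y\setminus C_n)$ is a computable sequence of c.e. open sets. Let $\nu$ be a computable Borel probability measure on $Y$, i.e. $\nu(U)$ is left-c.e. uniformly as $U$ ranges over the c.e. open sets. A point $y\in Y$ is Schnorr $\nu$-random if $y\notin\bigcap_n U_n$ for every computable sequence $(U_n)$ of c.e. open sets such that $\nu(U_n)\le 2^{-n}$ for all $n$ and the reals $\nu(U_n)$ are uniformly computable. A set $B\subseteq Y$ is $\nu$-effectively $\Sigma^0_2$ if $\nu(B)$ is a computable real and $B=\bigcup_i C_i$ for some computable sequence $(C_i)$ of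 effectively closed sets whose measures $\nu(C_i)$ are uniformly computable. Then a point $y\in Y$ is Schnorr $\nu$-random if and only if $y\in B$ for every $\nu$-effectively $\Sigma^0_2$ set $B\subseteq Y$ with $\nu(B)=1$. -/

import Mathlib

open MeasureTheory

noncomputable section

/-- The rational number `(a - b) / (c + 1)` coded by a triple of natural numbers `(a, b, c)`;
every rational number has a code. -/
def ratOfCode (q : ℕ × ℕ × ℕ) : ℚ := ((q.1 : ℚ) - (q.2.1 : ℚ)) / ((q.2.2 : ℚ) + 1)

/-- A real number is computable if rational approximations to within `2⁻ᵏ` can be computed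
from `k`. -/
def ComputableReal (x : ℝ) : Prop :=
  ∃ f : ℕ → ℕ × ℕ × ℕ, Computable f ∧ ∀ k, |x - (ratOfCode (f k) : ℝ)| ≤ (1 / 2 : ℝ) ^ k

/-- A family of real numbers is uniformly computable if rational approximations to within `2⁻ᵏ`
to its `i`-th member can be computed from `i` and `k`. -/
def UniformlyComputable {ι : Type*} [Primcodable ι] (x : ι → ℝ) : Prop :=
  ∃ f : ι × ℕ → ℕ × ℕ × ℕ, Computable f ∧
    ∀ i k, |x i - (ratOfCode (f (i, k)) : ℝ)| ≤ (1 / 2 : ℝ) ^ k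

/-- A sequence of real numbers is uniformly left-c.e. if the left cuts
`{q ∈ ℚ | q < x n}` are c.e. uniformly in `n`. -/
def UniformlyLeftCE (x : ℕ → ℝ) : Prop :=
  REPred fun p : ℕ × (ℕ × ℕ × ℕ) => (ratOfCode p.2 : ℝ) < x p.1

/-- A computable Polish space: a complete metric space with a distinguished dense sequence
of points whose mutual distances are uniformly computable. -/
class ComputablePolishSpace (Y : Type*) [MetricSpace Y] where
  complete : CompleteSpace Y
  point : ℕ → Y
  dense_point : DenseRange point
  computable_dist : UniformlyComputable fun p : ℕ × ℕ => dist (point p.1) (point p.2)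

section Effective

variable {Y : Type*} [MetricSpace Y] [ComputablePolishSpace Y]

/-- The basic open ball coded by `(i, a, b)`: its centre is the `i`-th distinguished point and its
radius is the positive rational `(a + 1) / (b + 1)`. -/
def basicBall (Y : Type*) [MetricSpace Y] [ComputablePolishSpace Y] (c : ℕ × ℕ × ℕ) : Set Y :=
  Metric.ball (ComputablePolishSpace.point c.1) (((c.2.1 : ℝ) + 1) / ((c.2.2 : ℝ) + 1))

/-- A computable sequence of c.e. open sets: `U n` is a union of basic open balls whose codes are
enumerated uniformly in `n`. -/
def IsComputableSeqCEOpen (U : ℕ → Set Y) : Prop :=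
  ∃ W : ℕ × (ℕ × ℕ × ℕ) → Prop, REPred W ∧
    ∀ n, U n = ⋃ (c : ℕ × ℕ × ℕ) (_ : W (n, c)), basicBall Y c

/-- A computable sequence of effectively closed sets: the complements form a computable sequence
of c.e. open sets. -/
def IsComputableSeqEffClosed (C : ℕ → Set Y) : Prop :=
  IsComputableSeqCEOpen fun n => (C n)ᶜ

variable [MeasurableSpace Y]

/-- The measure `ν` is computable: `ν U` is left-c.e. uniformly as `U` ranges over the c.e. open
sets. As the c.e. open sets, listed by their c.e. indices, form a computable sequence, uniformity
in an index for `U` is the same as uniformity along every computable sequence of c.e. open sets. -/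
def IsComputableMeasure (ν : Measure Y) : Prop :=
  ∀ U : ℕ → Set Y, IsComputableSeqCEOpen U → UniformlyLeftCE fun n => ν.real (U n)

/-- Sequential Schnorr `ν`-tests. -/
def IsSchnorrTest (ν : Measure Y) (U : ℕ → Set Y) : Prop :=
  IsComputableSeqCEOpen U ∧ (UniformlyComputable fun n => ν.real (U n)) ∧
    ∀ n, ν.real (U n) ≤ (1 / 2 : ℝ) ^ n

/-- Schnorr `ν`-random points. -/
def IsSchnorrRandom (ν : Measure Y) (y : Y) : Prop :=
  ∀ U : ℕ → Set Y, IsSchnorrTest ν U → y ∉ ⋂ n, U n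

/-- `ν`-effectively `Σ⁰₂` classes. -/
def IsEffectivelySigma02 (ν : Measure Y) (B : Set Y) : Prop :=
  ComputableReal (ν.real B) ∧
    ∃ C : ℕ → Set Y, IsComputableSeqEffClosed C ∧ (UniformlyComputable fun i => ν.real (C i)) ∧
      B = ⋃ i, C i

end Effective

end

/-! Complementation turns a computable sequence of effectively closed sets with union of full
measure into a computable sequence of c.e. open sets `V n` with null intersection, and `1 - x`
carries computable measures across. A Schnorr test is such a sequence, which gives one direction.

For the other, a test must be extracted from `V`. The sets `D n = ⋂ i < n, V i` decrease, their
measures tend to 0, and a search finds `g n` with `ν (D (g n)) < 2⁻ⁿ`. The crux is that `ν (D n)` is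
computable, not merely left-c.e.: `ν (D n) - ν (D (n + 1)) = ν (D n ∪ V n) - ν (V n)` is left-c.e.
because `ν (V n)` is computable, and telescoping from `ν (D 0) = 1` makes `-ν (D n)` left-c.e. too
(`IsComputableMeasure.uniformlyComputable_iInter_lt`). -/

namespace REPred

/-! ### Closure properties and choice for r.e. predicates -/

variable {α β : Type*} [Primcodable α] [Primcodable β]

theorem comp {p : β → Prop} (hp : REPred p) {f : α → β} (hf : Computable f) :
    REPred fun a => p (f a) :=
  Partrec.comp hp hf

theorem and {p q : α → Prop} (hp : REPred p) (hq : REPred q) : REPred fun a => p a ∧ q a := by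
  have h := (Partrec.bind hp (Partrec.comp hq Computable.fst).to₂).dom_re
  refine h.of_eq fun a => ?_
  simp [Part.assert]

theorem or {p q : α → Prop} (hp : REPred p) (hq : REPred q) : REPred fun a => p a ∨ q a := by
  obtain ⟨k, hk, h⟩ := Partrec.merge hp hq fun _ _ _ _ _ => rfl
  refine hk.dom_re.of_eq fun a => ?_
  simp [Part.dom_iff_mem, h]

/-- A bounded universal quantifier preserves recursive enumerability. -/
theorem forall_lt {p : ℕ × α → Prop} (hp : REPred p) :
    REPred fun a : ℕ × α => ∀ i < a.1, p (i, a.2) := by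
  -- The recursion runs through `i < n` and diverges at the first failure of `p`, so it halts
  -- exactly when all instances hold.
  have hstep : Partrec₂ fun (a : ℕ × α) (y : ℕ × Unit) =>
      Part.assert (p (y.1, a.2)) fun _ => Part.some () :=
    Partrec.comp hp ((Computable.fst.comp Computable.snd).pair
      (Computable.snd.comp Computable.fst))
  have h := (Partrec.nat_rec (f := fun a : ℕ × α => a.1) Computable.fst
    (Computable.const ()).partrec hstep).dom_re
  refine h.of_eq fun a => ?_
  obtain ⟨n, x⟩ := a
  dsimp only
  induction n with
  | zero => simp
  | succ n ih =>
    rw [Nat.forall_lt_succ_right, ← ih]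
    simp [Part.assert]

/-- A recursively enumerable predicate is the projection of a decidable one. -/
theorem exists_stage {p : α → Prop} (hp : REPred p) :
    ∃ F : α → ℕ → Bool, Computable₂ F ∧ ∀ a, p a ↔ ∃ k, F a k = true := by
  obtain ⟨c, hc⟩ := Nat.Partrec.Code.exists_code.1 hp
  refine ⟨fun a k => (c.evaln k (Encodable.encode a)).isSome, ?_, fun a => ?_⟩
  · exact Primrec.option_isSome.to_comp.comp (Nat.Partrec.Code.primrec_evaln.to_comp.comp
      ((Computable.snd.pair (Computable.const c)).pair
        (Computable.encode.comp Computable.fst)))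
  · have h : p a ↔ ∃ x, x ∈ c.eval (Encodable.encode a) := by
      rw [hc]; simp
    simp only [h, Nat.Partrec.Code.evaln_complete, Option.isSome_iff_exists, Option.mem_def]
    exact exists_comm

/-- A recursively enumerable relation has a partial recursive choice function. -/
theorem uniformization {p : α × β → Prop} (hp : REPred p) :
    ∃ G : α →. β, Partrec G ∧ (∀ a, ∀ b ∈ G a, p (a, b)) ∧
      ∀ a, (G a).Dom ↔ ∃ b, p (a, b) := by
  obtain ⟨F, hF, hpF⟩ := hp.exists_stage
  -- The search index `n` codes a pair: a candidate `b` and a stage at which to test it.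
  let g : α → ℕ → Option β := fun a n =>
    (Encodable.decode (α := β) n.unpair.1).bind fun b =>
      bif F (a, b) n.unpair.2 then some b else none
  have hg : Computable₂ g := by
    refine Computable.option_bind (Computable.decode.comp ((Computable.fst.comp
      Computable.unpair).comp Computable.snd)) ?_
    refine Computable.cond (hF.comp ((Computable.fst.comp Computable.fst).pair Computable.snd)
      ((Computable.snd.comp Computable.unpair).comp (Computable.snd.comp Computable.fst)))
      (Computable.option_some.comp Computable.snd) (Computable.const none)
  have hmem : ∀ a b n, b ∈ g a n ↔
      Encodable.decode (α := β) n.unpair.1 = some b ∧ F (a, b) n.unpair.2 = true := by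
    intro a b n
    simp only [g, Option.mem_def, Option.bind_eq_some_iff]
    constructor
    · rintro ⟨b', hb', h⟩
      cases hF' : F (a, b') n.unpair.2 <;> simp_all
    · rintro ⟨h₁, h₂⟩
      exact ⟨b, h₁, by simp [h₂]⟩
  refine ⟨fun a => Nat.rfindOpt (g a), Partrec.rfindOpt hg, fun a b hb => ?_, fun a => ?_⟩
  · obtain ⟨n, hn⟩ := Nat.rfindOpt_spec hb
    exact (hpF _).2 ⟨_, ((hmem _ _ _).1 hn).2⟩
  · rw [Nat.rfindOpt_dom]
    constructor
    · rintro ⟨n, b, hn⟩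
      exact ⟨b, (hpF _).2 ⟨_, ((hmem _ _ _).1 hn).2⟩⟩
    · rintro ⟨b, hb⟩
      obtain ⟨k, hk⟩ := (hpF _).1 hb
      exact ⟨Nat.pair (Encodable.encode b) k, b, (hmem _ _ _).2 (by simp [hk])⟩

theorem exists_right {p : α × β → Prop} (hp : REPred p) : REPred fun a => ∃ b, p (a, b) := by
  obtain ⟨G, hG, -, hdom⟩ := hp.uniformization
  exact hG.dom_re.of_eq hdom

/-- A total recursively enumerable relation has a computable choice function. -/
theorem exists_computable_choice {p : α × β → Prop} (hp : REPred p) (h : ∀ a, ∃ b, p (a, b)) :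
    ∃ f : α → β, Computable f ∧ ∀ a, p (a, f a) := by
  obtain ⟨G, hG, hmem, hdom⟩ := hp.uniformization
  have hd : ∀ a, (G a).Dom := fun a => (hdom a).2 (h a)
  exact ⟨fun a => (G a).get (hd a), hG.of_eq_tot fun a => Part.get_mem _,
    fun a => hmem a _ (Part.get_mem _)⟩

end REPred

/-! ### Arithmetic of rational codes -/

theorem exists_ratOfCode_eq (q : ℚ) : ∃ c, ratOfCode c = q := by
  refine ⟨(q.num.toNat, (-q.num).toNat, q.den - 1), ?_⟩
  have h₁ : ((q.num.toNat : ℚ) - ((-q.num).toNat : ℚ)) = q.num := by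
    exact_mod_cast Int.toNat_sub_toNat_neg q.num
  have h₂ : ((q.den - 1 : ℕ) : ℚ) + 1 = q.den := by
    exact_mod_cast Nat.sub_add_cancel q.pos
  simp only [ratOfCode, h₁, h₂, Rat.num_div_den]

theorem exists_ratOfCode_btwn {x y : ℝ} (h : x < y) :
    ∃ c, x < (ratOfCode c : ℝ) ∧ (ratOfCode c : ℝ) < y := by
  obtain ⟨q, hq⟩ := exists_rat_btwn h
  obtain ⟨c, rfl⟩ := exists_ratOfCode_eq q
  exact ⟨c, hq⟩

/-- A code of the sum of two coded rational numbers. -/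
def ratCodeAdd (q r : ℕ × ℕ × ℕ) : ℕ × ℕ × ℕ :=
  (q.1 * (r.2.2 + 1) + r.1 * (q.2.2 + 1), q.2.1 * (r.2.2 + 1) + r.2.1 * (q.2.2 + 1),
    q.2.2 * r.2.2 + q.2.2 + r.2.2)

/-- A code of the rational number `(1 / 2) ^ k`. -/
def ratCodeHalfPow (k : ℕ) : ℕ × ℕ × ℕ := (1, 0, 2 ^ k - 1)

/-- A code of the negative of a coded rational number. -/
def ratCodeNeg (q : ℕ × ℕ × ℕ) : ℕ × ℕ × ℕ := (q.2.1, q.1, q.2.2)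

@[simp] theorem ratOfCode_add (q r : ℕ × ℕ × ℕ) :
    ratOfCode (ratCodeAdd q r) = ratOfCode q + ratOfCode r := by
  have h₁ : (q.2.2 : ℚ) + 1 ≠ 0 := by positivity
  have h₂ : (r.2.2 : ℚ) + 1 ≠ 0 := by positivity
  have h₃ : (q.2.2 : ℚ) * r.2.2 + q.2.2 + r.2.2 + 1 = (q.2.2 + 1) * (r.2.2 + 1) := by ring
  simp only [ratOfCode, ratCodeAdd, Nat.cast_add, Nat.cast_mul, Nat.cast_one, h₃]
  field_simp
  ring

@[simp] theorem ratOfCode_halfPow (k : ℕ) : ratOfCode (ratCodeHalfPow k) = (1 / 2) ^ k := by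
  simp [ratOfCode, ratCodeHalfPow]

@[simp] theorem ratOfCode_neg (q : ℕ × ℕ × ℕ) : ratOfCode (ratCodeNeg q) = -ratOfCode q := by
  simp only [ratOfCode, ratCodeNeg]
  ring

theorem primrec_ratCodeAdd : Primrec₂ ratCodeAdd := by
  have a₁ : Primrec fun p : (ℕ × ℕ × ℕ) × (ℕ × ℕ × ℕ) => p.1.1 := Primrec.fst.comp Primrec.fst
  have b₁ : Primrec fun p : (ℕ × ℕ × ℕ) × (ℕ × ℕ × ℕ) => p.1.2.1 :=
    Primrec.fst.comp (Primrec.snd.comp Primrec.fst)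
  have c₁ : Primrec fun p : (ℕ × ℕ × ℕ) × (ℕ × ℕ × ℕ) => p.1.2.2 :=
    Primrec.snd.comp (Primrec.snd.comp Primrec.fst)
  have a₂ : Primrec fun p : (ℕ × ℕ × ℕ) × (ℕ × ℕ × ℕ) => p.2.1 := Primrec.fst.comp Primrec.snd
  have b₂ : Primrec fun p : (ℕ × ℕ × ℕ) × (ℕ × ℕ × ℕ) => p.2.2.1 :=
    Primrec.fst.comp (Primrec.snd.comp Primrec.snd)
  have c₂ : Primrec fun p : (ℕ × ℕ × ℕ) × (ℕ × ℕ × ℕ) => p.2.2.2 :=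
    Primrec.snd.comp (Primrec.snd.comp Primrec.snd)
  have s₁ := Primrec.succ.comp c₁
  have s₂ := Primrec.succ.comp c₂
  exact (Primrec.nat_add.comp (Primrec.nat_mul.comp a₁ s₂) (Primrec.nat_mul.comp a₂ s₁)).pair
    ((Primrec.nat_add.comp (Primrec.nat_mul.comp b₁ s₂) (Primrec.nat_mul.comp b₂ s₁)).pair
      (Primrec.nat_add.comp (Primrec.nat_add.comp (Primrec.nat_mul.comp c₁ c₂) c₁) c₂))

theorem primrec_ratCodeNeg : Primrec ratCodeNeg :=
  (Primrec.fst.comp Primrec.snd).pair (Primrec.fst.pair (Primrec.snd.comp Primrec.snd))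

theorem primrec_ratCodeHalfPow : Primrec ratCodeHalfPow :=
  (Primrec.const 1).pair ((Primrec.const 0).pair (Primrec.nat_sub.comp
    ((Primrec₂.unpaired'.1 Nat.Primrec.pow).comp (Primrec.const 2) Primrec.id) (Primrec.const 1)))

/-- A code of the sum of the first `n` rational numbers coded by the members of a list, which is
continued by zeros. -/
def ratCodeSum (l : List (ℕ × ℕ × ℕ)) (n : ℕ) : ℕ × ℕ × ℕ :=
  Nat.rec (0, 0, 0) (fun i r => ratCodeAdd r (l.getD i (0, 0, 0))) n

theorem ratOfCode_sum (l : List (ℕ × ℕ × ℕ)) (n : ℕ) :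
    ratOfCode (ratCodeSum l n) = ∑ i ∈ Finset.range n, ratOfCode (l.getD i (0, 0, 0)) := by
  induction n with
  | zero => simp [ratCodeSum, ratOfCode]
  | succ n ih => rw [Finset.sum_range_succ, ← ih, ← ratOfCode_add]; rfl

theorem primrec_ratCodeSum : Primrec₂ ratCodeSum := by
  have hstep : Primrec₂ fun (l : List (ℕ × ℕ × ℕ)) (p : ℕ × (ℕ × ℕ × ℕ)) =>
      ratCodeAdd p.2 (l.getD p.1 (0, 0, 0)) :=
    primrec_ratCodeAdd.comp (Primrec.snd.comp Primrec.snd)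
      ((Primrec.list_getD (0, 0, 0)).comp Primrec.fst (Primrec.fst.comp Primrec.snd))
  exact Primrec.nat_rec (Primrec.const (0, 0, 0)) hstep

theorem ratOfCode_pos_iff (q : ℕ × ℕ × ℕ) : 0 < ratOfCode q ↔ q.2.1 < q.1 := by
  have h : (0 : ℚ) < (q.2.2 : ℚ) + 1 := by positivity
  rw [ratOfCode, div_pos_iff_of_pos_right h, sub_pos, Nat.cast_lt]

/-- Strict inequality between coded rational numbers is recursively enumerable. -/
theorem rePred_ratOfCode_lt {α : Type*} [Primcodable α] {f g : α → ℕ × ℕ × ℕ}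
    (hf : Computable f) (hg : Computable g) :
    REPred fun a => (ratOfCode (f a) : ℝ) < ratOfCode (g a) := by
  have hd : Computable fun a => ratCodeAdd (g a) (ratCodeNeg (f a)) :=
    primrec_ratCodeAdd.to_comp.comp hg (primrec_ratCodeNeg.to_comp.comp hf)
  have hlt : REPred fun q : ℕ × ℕ × ℕ => q.2.1 < q.1 :=
    (ComputablePred.to_re (PrimrecPred.computablePred
      (PrimrecRel.comp Primrec.nat_lt (Primrec.fst.comp Primrec.snd) Primrec.fst)))
  refine (hlt.comp hd).of_eq fun a => ?_
  rw [← ratOfCode_pos_iff, ratOfCode_add, ratOfCode_neg, ← sub_eq_add_neg, sub_pos, Rat.cast_lt]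

/-! ### Lower semicomputable families of reals -/

/-- A family of reals is lower semicomputable if the rationals below its `i`-th member are
enumerable uniformly in `i`. -/
def LowerSemicomputable {ι : Type*} [Primcodable ι] (x : ι → ℝ) : Prop :=
  REPred fun p : ι × (ℕ × ℕ × ℕ) => (ratOfCode p.2 : ℝ) < x p.1

section

variable {ι κ : Type*} [Primcodable ι] [Primcodable κ]

theorem UniformlyComputable.comp {x : ι → ℝ} (hx : UniformlyComputable x) {g : κ → ι}
    (hg : Computable g) : UniformlyComputable fun j => x (g j) := by
  obtain ⟨f, hf, h⟩ := hx
  exact ⟨fun p => f (g p.1, p.2), hf.comp ((hg.comp Computable.fst).pair Computable.snd),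
    fun j k => h (g j) k⟩

theorem UniformlyComputable.neg {x : ι → ℝ} (hx : UniformlyComputable x) :
    UniformlyComputable fun i => -x i := by
  obtain ⟨f, hf, h⟩ := hx
  refine ⟨fun p => ratCodeNeg (f p), primrec_ratCodeNeg.to_comp.comp hf, fun i k => ?_⟩
  rw [ratOfCode_neg, Rat.cast_neg, ← neg_sub', abs_neg]
  exact h i k

theorem UniformlyComputable.rat_add {x : ι → ℝ} (hx : UniformlyComputable x)
    {g : ι → ℕ × ℕ × ℕ} (hg : Computable g) :
    UniformlyComputable fun i => (ratOfCode (g i) : ℝ) + x i := by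
  obtain ⟨f, hf, h⟩ := hx
  refine ⟨fun p => ratCodeAdd (g p.1) (f p),
    primrec_ratCodeAdd.to_comp.comp (hg.comp Computable.fst) hf, fun i k => ?_⟩
  rw [ratOfCode_add, Rat.cast_add, add_sub_add_left_eq_sub]
  exact h i k

theorem UniformlyComputable.one_sub {x : ι → ℝ} (hx : UniformlyComputable x) :
    UniformlyComputable fun i => 1 - x i := by
  have h := hx.neg.rat_add (Computable.const (1, 0, 0))
  have hone : (ratOfCode (1, 0, 0) : ℝ) = 1 := by simp [ratOfCode]
  simpa only [hone, ← sub_eq_add_neg] using h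

/-- A rational `q` is below `x i` iff some approximation of precision `2⁻ᵏ` exceeds `q + 2⁻ᵏ`. -/
theorem UniformlyComputable.lowerSemicomputable {x : ι → ℝ} (hx : UniformlyComputable x) :
    LowerSemicomputable x := by
  obtain ⟨f, hf, h⟩ := hx
  have hre : REPred fun p : (ι × (ℕ × ℕ × ℕ)) × ℕ =>
      (ratOfCode (ratCodeAdd p.1.2 (ratCodeHalfPow p.2)) : ℝ) < ratOfCode (f (p.1.1, p.2)) :=
    rePred_ratOfCode_lt
      (primrec_ratCodeAdd.to_comp.comp (Computable.snd.comp Computable.fst)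
        (primrec_ratCodeHalfPow.to_comp.comp Computable.snd))
      (hf.comp ((Computable.fst.comp Computable.fst).pair Computable.snd))
  refine hre.exists_right.of_eq fun ⟨i, q⟩ => ?_
  simp only [ratOfCode_add, ratOfCode_halfPow, Rat.cast_add, Rat.cast_pow, Rat.cast_div,
    Rat.cast_one, Rat.cast_ofNat]
  constructor
  · rintro ⟨k, hk⟩
    have := abs_le.1 (h i k)
    linarith
  · intro hq
    -- Half the gap, since `2⁻ᵏ` is spent twice: as the margin and as the approximation error.
    obtain ⟨k, hk⟩ := exists_pow_lt_of_lt_one (half_pos (sub_pos.2 hq)) one_half_lt_one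
    have := abs_le.1 (h i k)
    exact ⟨k, by linarith⟩

namespace LowerSemicomputable

theorem comp {x : ι → ℝ} (hx : LowerSemicomputable x) {g : κ → ι} (hg : Computable g) :
    LowerSemicomputable fun j => x (g j) :=
  REPred.comp (p := fun p : ι × (ℕ × ℕ × ℕ) => (ratOfCode p.2 : ℝ) < x p.1) hx
    (f := fun p : κ × (ℕ × ℕ × ℕ) => (g p.1, p.2))
    ((hg.comp Computable.fst).pair Computable.snd)

theorem rePred_lt {x : ι → ℝ} (hx : LowerSemicomputable x) {g : ι → ℕ × ℕ × ℕ}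
    (hg : Computable g) : REPred fun i => (ratOfCode (g i) : ℝ) < x i :=
  REPred.comp (p := fun p : ι × (ℕ × ℕ × ℕ) => (ratOfCode p.2 : ℝ) < x p.1) hx
    (f := fun i => (i, g i)) (Computable.id.pair hg)

/-- Left cuts are open: `q < x + y` iff rationals `a < x` and `b < y` satisfy `q < a + b`. -/
theorem add {x y : ι → ℝ} (hx : LowerSemicomputable x) (hy : LowerSemicomputable y) :
    LowerSemicomputable fun i => x i + y i := by
  have h₁ : REPred fun p : (ι × (ℕ × ℕ × ℕ)) × ((ℕ × ℕ × ℕ) × (ℕ × ℕ × ℕ)) =>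
      (ratOfCode p.2.1 : ℝ) < x p.1.1 :=
    (hx.comp (Computable.fst.comp Computable.fst)).rePred_lt (Computable.fst.comp Computable.snd)
  have h₂ : REPred fun p : (ι × (ℕ × ℕ × ℕ)) × ((ℕ × ℕ × ℕ) × (ℕ × ℕ × ℕ)) =>
      (ratOfCode p.2.2 : ℝ) < y p.1.1 :=
    (hy.comp (Computable.fst.comp Computable.fst)).rePred_lt (Computable.snd.comp Computable.snd)
  have h₃ : REPred fun p : (ι × (ℕ × ℕ × ℕ)) × ((ℕ × ℕ × ℕ) × (ℕ × ℕ × ℕ)) =>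
      (ratOfCode p.1.2 : ℝ) < ratOfCode (ratCodeAdd p.2.1 p.2.2) :=
    rePred_ratOfCode_lt (Computable.snd.comp Computable.fst)
      (primrec_ratCodeAdd.to_comp.comp (Computable.fst.comp Computable.snd)
        (Computable.snd.comp Computable.snd))
  refine ((h₁.and h₂).and h₃).exists_right.of_eq fun ⟨i, q⟩ => ?_
  simp only [ratOfCode_add, Rat.cast_add]
  constructor
  · rintro ⟨⟨a, b⟩, ⟨ha, hb⟩, hab⟩
    exact hab.trans (add_lt_add ha hb)
  · intro hq
    obtain ⟨a, ha, ha'⟩ := exists_ratOfCode_btwn (sub_lt_iff_lt_add.2 hq)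
    obtain ⟨b, hb, hb'⟩ := exists_ratOfCode_btwn (sub_lt_comm.1 ha)
    exact ⟨(a, b), ⟨ha', hb'⟩, by linarith⟩

/-- Partial sums of a lower semicomputable sequence are lower semicomputable. -/
theorem sum_range {x : ℕ → ℝ} (hx : LowerSemicomputable x) :
    LowerSemicomputable fun n => ∑ i ∈ Finset.range n, x i := by
  have hlt : REPred fun p : ℕ × List (ℕ × ℕ × ℕ) =>
      (ratOfCode (p.2.getD p.1 (0, 0, 0)) : ℝ) < x p.1 :=
    (hx.comp Computable.fst).rePred_lt
      ((Primrec.list_getD (0, 0, 0)).to_comp.comp Computable.snd Computable.fst)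
  have h₁ : REPred fun p : (ℕ × (ℕ × ℕ × ℕ)) × List (ℕ × ℕ × ℕ) =>
      ∀ i < p.1.1, (ratOfCode (p.2.getD i (0, 0, 0)) : ℝ) < x i :=
    REPred.comp (f := fun p : (ℕ × (ℕ × ℕ × ℕ)) × List (ℕ × ℕ × ℕ) => (p.1.1, p.2))
      hlt.forall_lt ((Computable.fst.comp Computable.fst).pair Computable.snd)
  have h₂ : REPred fun p : (ℕ × (ℕ × ℕ × ℕ)) × List (ℕ × ℕ × ℕ) =>
      (ratOfCode p.1.2 : ℝ) < ratOfCode (ratCodeSum p.2 p.1.1) :=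
    rePred_ratOfCode_lt (Computable.snd.comp Computable.fst)
      (primrec_ratCodeSum.to_comp.comp Computable.snd (Computable.fst.comp Computable.fst))
  refine (h₁.and h₂).exists_right.of_eq fun ⟨n, q⟩ => ?_
  simp only [ratOfCode_sum, Rat.cast_sum]
  constructor
  · rintro ⟨l, hl, hq⟩
    exact hq.trans_le (Finset.sum_le_sum fun i hi => (hl i (Finset.mem_range.1 hi)).le)
  · intro hq
    -- The length is tracked so that an appended code lands at index `n`.
    have key : ∀ (n : ℕ) (t : ℝ), t < ∑ i ∈ Finset.range n, x i → ∃ l : List (ℕ × ℕ × ℕ), l.length = n ∧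
        (∀ i < n, (ratOfCode (l.getD i (0, 0, 0)) : ℝ) < x i) ∧
        t < ∑ i ∈ Finset.range n, (ratOfCode (l.getD i (0, 0, 0)) : ℝ) := by
      intro n
      induction n with
      | zero => exact fun t ht => ⟨[], rfl, by simp, by simpa using ht⟩
      | succ n ih =>
        intro t ht
        rw [Finset.sum_range_succ] at ht
        obtain ⟨c, hc, hc'⟩ := exists_ratOfCode_btwn (sub_lt_iff_lt_add'.2 ht)
        obtain ⟨l, hlen, hl, hsum⟩ := ih _ (sub_lt_comm.1 hc)
        have hlt : ∀ i < n, (l ++ [c]).getD i (0, 0, 0) = l.getD i (0, 0, 0) := fun i hi =>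
          List.getD_append _ _ _ _ (hlen ▸ hi)
        have hn : (l ++ [c]).getD n (0, 0, 0) = c := by simp [← hlen]
        refine ⟨l ++ [c], by simp [hlen], ?_, ?_⟩
        · rw [Nat.forall_lt_succ_right, hn]
          exact ⟨fun i hi => by rw [hlt i hi]; exact hl i hi, hc'⟩
        · rw [Finset.sum_range_succ, hn, Finset.sum_congr rfl fun i hi => by
            rw [hlt i (Finset.mem_range.1 hi)]]
          linarith
    obtain ⟨l, -, h⟩ := key n _ hq
    exact ⟨l, h⟩

/-- A family that is semicomputable both from below and from above is computable. -/
theorem uniformlyComputable {x : ι → ℝ} (hx : LowerSemicomputable x)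
    (hx' : LowerSemicomputable fun i => -x i) : UniformlyComputable x := by
  have h₁ : REPred fun p : (ι × ℕ) × ((ℕ × ℕ × ℕ) × (ℕ × ℕ × ℕ)) =>
      (ratOfCode p.2.1 : ℝ) < x p.1.1 :=
    (hx.comp (Computable.fst.comp Computable.fst)).rePred_lt (Computable.fst.comp Computable.snd)
  have h₂ : REPred fun p : (ι × ℕ) × ((ℕ × ℕ × ℕ) × (ℕ × ℕ × ℕ)) =>
      (ratOfCode p.2.2 : ℝ) < -x p.1.1 :=
    (hx'.comp (Computable.fst.comp Computable.fst)).rePred_lt (Computable.snd.comp Computable.snd)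
  -- With `a < x` and `b < -x`, the condition `-2⁻ᵏ < a + b` forces `x - a < 2⁻ᵏ`.
  have h₃ : REPred fun p : (ι × ℕ) × ((ℕ × ℕ × ℕ) × (ℕ × ℕ × ℕ)) =>
      (ratOfCode (ratCodeNeg (ratCodeHalfPow p.1.2)) : ℝ) < ratOfCode (ratCodeAdd p.2.1 p.2.2) :=
    rePred_ratOfCode_lt (primrec_ratCodeNeg.to_comp.comp (primrec_ratCodeHalfPow.to_comp.comp
      (Computable.snd.comp Computable.fst)))
      (primrec_ratCodeAdd.to_comp.comp (Computable.fst.comp Computable.snd)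
        (Computable.snd.comp Computable.snd))
  obtain ⟨f, hf, h⟩ := ((h₁.and h₂).and h₃).exists_computable_choice fun ⟨i, k⟩ => by
    have hk : (0 : ℝ) < (1 / 2) ^ k := by positivity
    obtain ⟨a, ha, ha'⟩ := exists_ratOfCode_btwn (sub_lt_self (x i) (half_pos hk))
    obtain ⟨b, hb, hb'⟩ := exists_ratOfCode_btwn (sub_lt_self (-x i) (half_pos hk))
    refine ⟨(a, b), ⟨ha', hb'⟩, ?_⟩
    simp only [ratOfCode_add, ratOfCode_neg, ratOfCode_halfPow]
    push_cast
    linarith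
  refine ⟨fun p => (f p).1, Computable.fst.comp hf, fun i k => ?_⟩
  obtain ⟨⟨ha, hb⟩, hab⟩ := h (i, k)
  simp only [ratOfCode_add, ratOfCode_neg, ratOfCode_halfPow] at ha hb hab
  push_cast at hab
  rw [abs_le]
  constructor <;> linarith

end LowerSemicomputable

end

/-! ### Computable sequences of c.e. open sets -/

section Effective

variable {Y : Type*} [MetricSpace Y] [ComputablePolishSpace Y]

open ComputablePolishSpace (point)

/-- The rational radius of the coded basic ball. -/
noncomputable def ballRadius (c : ℕ × ℕ × ℕ) : ℝ := ((c.2.1 : ℝ) + 1) / ((c.2.2 : ℝ) + 1)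

/-- The coded ball `c` is contained in the coded ball `c'` because of the distance of the centres
and the difference of the radii. -/
def FormallyInside (Y : Type*) [MetricSpace Y] [ComputablePolishSpace Y]
    (c c' : ℕ × ℕ × ℕ) : Prop :=
  dist (point c.1 : Y) (point c'.1) + ballRadius c < ballRadius c'

theorem FormallyInside.subset {c c' : ℕ × ℕ × ℕ} (h : FormallyInside Y c c') :
    basicBall Y c ⊆ basicBall Y c' :=
  Metric.ball_subset_ball' (by rw [add_comm]; exact h.le)

/-- Unlike set inclusion, this is a strict inequality between computable reals, hence enumerable. -/
theorem rePred_formallyInside :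
    REPred fun p : (ℕ × ℕ × ℕ) × (ℕ × ℕ × ℕ) => FormallyInside Y p.1 p.2 := by
  let r : ℕ × ℕ × ℕ → ℕ × ℕ × ℕ := fun c => (c.2.1 + 1, 0, c.2.2)
  have hr : Computable r := Primrec.to_comp
    ((Primrec.succ.comp (Primrec.fst.comp Primrec.snd)).pair
      ((Primrec.const 0).pair (Primrec.snd.comp Primrec.snd)))
  have hr' : ∀ c, (ratOfCode (r c) : ℝ) = ballRadius c := fun c => by
    simp [r, ratOfCode, ballRadius]
  have hdist : UniformlyComputable fun p : (ℕ × ℕ × ℕ) × (ℕ × ℕ × ℕ) =>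
      dist (point p.1.1 : Y) (point p.2.1) :=
    (ComputablePolishSpace.computable_dist (Y := Y)).comp
      ((Computable.fst.comp Computable.fst).pair (Computable.fst.comp Computable.snd))
  have h := (hdist.neg.rat_add (hr.comp Computable.snd)).lowerSemicomputable.rePred_lt
    (hr.comp Computable.fst)
  refine h.of_eq fun p => ?_
  rw [hr', hr', FormallyInside]
  constructor <;> intro h <;> linarith

theorem isOpen_basicBall (c : ℕ × ℕ × ℕ) : IsOpen (basicBall Y c) := Metric.isOpen_ball

/-- The coded balls formally inside the members of a finite family of coded balls with a common
point `y` include a neighbourhood of `y`. -/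
theorem exists_basicBall_formallyInside (y : Y) (n : ℕ) (c : ℕ → ℕ × ℕ × ℕ)
    (hc : ∀ i < n, y ∈ basicBall Y (c i)) :
    ∃ b, y ∈ basicBall Y b ∧ ∀ i < n, FormallyInside Y b (c i) := by
  -- A slack common to all `n` balls; a ball of radius below `δ / 2` centred within `δ / 2` of `y`
  -- then fits in each.
  obtain ⟨δ, hδ, h⟩ : ∃ δ : ℝ, 0 < δ ∧ ∀ i < n, dist y (point (c i).1) + δ ≤ ballRadius (c i) := by
    induction n with
    | zero => exact ⟨1, one_pos, by simp⟩
    | succ n ih =>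
      obtain ⟨δ, hδ, h⟩ := ih fun i hi => hc i (hi.trans n.lt_succ_self)
      have hn : dist y (point (c n).1) < ballRadius (c n) := hc n n.lt_succ_self
      refine ⟨min δ (ballRadius (c n) - dist y (point (c n).1)), lt_min hδ (sub_pos.2 hn), ?_⟩
      rw [Nat.forall_lt_succ_right]
      refine ⟨fun i hi => ?_, ?_⟩
      · have := min_le_left δ (ballRadius (c n) - dist y (point (c n).1))
        linarith [h i hi]
      · have := min_le_right δ (ballRadius (c n) - dist y (point (c n).1))
        linarith
  obtain ⟨m, hm⟩ := exists_nat_one_div_lt (half_pos hδ)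
  have hm0 : (0 : ℝ) < 1 / ((m : ℝ) + 1) := by positivity
  obtain ⟨j, hj⟩ := (ComputablePolishSpace.dense_point (Y := Y)).exists_dist_lt y hm0
  have hrad : ballRadius (j, 0, m) = 1 / ((m : ℝ) + 1) := by simp [ballRadius]
  refine ⟨(j, 0, m), ?_, fun i hi => ?_⟩
  · change dist y (point j) < ballRadius (j, 0, m)
    rwa [hrad]
  · change dist (point j) (point (c i).1) + ballRadius (j, 0, m) < ballRadius (c i)
    rw [hrad]
    have := dist_triangle_left (point j) (point (c i).1) y
    linarith [h i hi]

namespace IsComputableSeqCEOpen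

variable {U V : ℕ → Set Y}

theorem isOpen (hU : IsComputableSeqCEOpen U) (n : ℕ) : IsOpen (U n) := by
  obtain ⟨W, -, h⟩ := hU
  rw [h]
  exact isOpen_iUnion fun c => isOpen_iUnion fun _ => isOpen_basicBall c

theorem comp (hU : IsComputableSeqCEOpen U) {g : ℕ → ℕ} (hg : Computable g) :
    IsComputableSeqCEOpen fun n => U (g n) := by
  obtain ⟨W, hW, h⟩ := hU
  exact ⟨fun p => W (g p.1, p.2), hW.comp ((hg.comp Computable.fst).pair Computable.snd),
    fun n => h (g n)⟩

theorem union (hU : IsComputableSeqCEOpen U) (hV : IsComputableSeqCEOpen V) :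
    IsComputableSeqCEOpen fun n => U n ∪ V n := by
  obtain ⟨W, hW, h⟩ := hU
  obtain ⟨W', hW', h'⟩ := hV
  refine ⟨fun p => W p ∨ W' p, hW.or hW', fun n => ?_⟩
  simp only [h, h', Set.iUnion_or, Set.iUnion_union_distrib]

/-- The finite initial intersections of a computable sequence of c.e. open sets form a computable
sequence of c.e. open sets. -/
theorem iInter_lt (hU : IsComputableSeqCEOpen U) :
    IsComputableSeqCEOpen fun n => ⋂ i < n, U i := by
  obtain ⟨W, hW, h⟩ := hU
  -- A ball is enumerated for `⋂ i < n, U i` once it is formally inside some listed ball of each `U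
  -- i`; for `n = 0` every ball is.
  have hex : REPred fun p : ℕ × (ℕ × ℕ × ℕ) => ∃ c, W (p.1, c) ∧ FormallyInside Y p.2 c := by
    have h₁ : REPred fun p : (ℕ × (ℕ × ℕ × ℕ)) × (ℕ × ℕ × ℕ) => W (p.1.1, p.2) :=
      hW.comp (f := fun p : (ℕ × (ℕ × ℕ × ℕ)) × (ℕ × ℕ × ℕ) => (p.1.1, p.2))
        ((Computable.fst.comp Computable.fst).pair Computable.snd)
    have h₂ : REPred fun p : (ℕ × (ℕ × ℕ × ℕ)) × (ℕ × ℕ × ℕ) => FormallyInside Y p.1.2 p.2 :=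
      rePred_formallyInside.comp (f := fun p : (ℕ × (ℕ × ℕ × ℕ)) × (ℕ × ℕ × ℕ) => (p.1.2, p.2))
        ((Computable.snd.comp Computable.fst).pair Computable.snd)
    exact (h₁.and h₂).exists_right
  refine ⟨_, hex.forall_lt, fun n => ?_⟩
  ext y
  simp only [Set.mem_iInter, Set.mem_iUnion, exists_prop, h]
  constructor
  · intro hy
    choose! c hcW hc using hy
    obtain ⟨b, hb, hbc⟩ := exists_basicBall_formallyInside y n c hc
    exact ⟨b, fun i hi => ⟨c i, hcW i hi, hbc i hi⟩, hb⟩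
  · rintro ⟨b, hb, hy⟩ i hi
    obtain ⟨c, hc, hbc⟩ := hb i hi
    exact ⟨c, hc, hbc.subset hy⟩

end IsComputableSeqCEOpen

/-! ### Measures of finite intersections and extraction of a Schnorr test -/

variable [MeasurableSpace Y] [BorelSpace Y] {ν : Measure Y} [IsProbabilityMeasure ν]

theorem IsComputableMeasure.lowerSemicomputable {Y : Type*} [MetricSpace Y]
    [ComputablePolishSpace Y] [MeasurableSpace Y] {ν : Measure Y} (hν : IsComputableMeasure ν)
    {U : ℕ → Set Y} (hU : IsComputableSeqCEOpen U) :
    LowerSemicomputable fun n => ν.real (U n) :=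
  hν U hU

/-- If the measures of a computable sequence of c.e. open sets are uniformly computable, then so
are the measures of its finite initial intersections. -/
theorem IsComputableMeasure.uniformlyComputable_iInter_lt (hν : IsComputableMeasure ν)
    {V : ℕ → Set Y} (hV : IsComputableSeqCEOpen V)
    (hVν : UniformlyComputable fun n => ν.real (V n)) :
    UniformlyComputable fun n => ν.real (⋂ i < n, V i) := by
  have hnegone : (ratOfCode (0, 1, 0) : ℝ) = -1 := by simp [ratOfCode]
  have hdiff : LowerSemicomputable fun n =>
      ν.real (⋂ i < n, V i) - ν.real (⋂ i < n + 1, V i) := by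
    -- Modularity of `ν` rewrites the decrement as `ν (D ∪ V n) - ν (V n)`, where `D = ⋂ i < n, V
    -- i`.
    have h := (hν.lowerSemicomputable (hV.iInter_lt.union hV)).add
      hVν.neg.lowerSemicomputable
    convert h using 2 with n
    have hinter : ⋂ i < n + 1, V i = (⋂ i < n, V i) ∩ V n := by
      ext y
      simp only [Set.mem_iInter, Set.mem_inter_iff, Nat.forall_lt_succ_right]
    have := measureReal_union_add_inter (μ := ν) (s := ⋂ i < n, V i)
      (hV.isOpen n).measurableSet
    rw [hinter]
    linarith
  have hneg : LowerSemicomputable fun n => -ν.real (⋂ i < n, V i) := by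
    have hconst : LowerSemicomputable fun _ : ℕ => (-1 : ℝ) := by
      have h : REPred fun p : ℕ × (ℕ × ℕ × ℕ) => (ratOfCode p.2 : ℝ) < ratOfCode (0, 1, 0) :=
        rePred_ratOfCode_lt Computable.snd (Computable.const _)
      rwa [hnegone] at h
    convert hconst.add hdiff.sum_range using 2 with n
    rw [Finset.sum_range_sub']
    simp only [not_lt_zero, Set.iInter_of_empty, Set.iInter_univ, probReal_univ]
    ring
  exact (hν.lowerSemicomputable hV.iInter_lt).uniformlyComputable hneg

/-- A computable sequence of c.e. open sets with uniformly computable measures and null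
intersection is covered by a Schnorr test. -/
theorem IsSchnorrRandom.notMem_iInter (hν : IsComputableMeasure ν) {y : Y}
    (hy : IsSchnorrRandom ν y) {V : ℕ → Set Y} (hV : IsComputableSeqCEOpen V)
    (hVν : UniformlyComputable fun n => ν.real (V n)) (hnull : ν (⋂ n, V n) = 0) :
    y ∉ ⋂ n, V n := by
  set D : ℕ → Set Y := fun n => ⋂ i < n, V i with hD
  have hDopen : IsComputableSeqCEOpen D := hV.iInter_lt
  have hDν : UniformlyComputable fun n => ν.real (D n) := hν.uniformlyComputable_iInter_lt hV hVν
  have hsub : ⋂ n, D n ⊆ ⋂ n, V n := fun z hz => by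
    simp only [hD, Set.mem_iInter] at hz ⊢
    exact fun n => hz (n + 1) n n.lt_succ_self
  have hanti : Antitone D := fun m n hmn =>
    Set.biInter_subset_biInter_left fun i (hi : i < m) => hi.trans_le hmn
  have hlim : Filter.Tendsto (fun n => ν.real (D n)) Filter.atTop (nhds 0) := by
    have h := tendsto_measure_iInter_atTop (μ := ν) (s := D)
      (fun n => (hDopen.isOpen n).measurableSet.nullMeasurableSet) hanti
      ⟨0, measure_ne_top ν _⟩
    rw [measure_mono_null hsub hnull] at h
    exact (ENNReal.tendsto_toReal ENNReal.zero_ne_top).comp h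
  -- Stated through negatives, so that the upper bound on `ν (D m)` becomes an enumerable lower
  -- bound.
  have hre : REPred fun p : ℕ × ℕ =>
      (ratOfCode (ratCodeNeg (ratCodeHalfPow p.1)) : ℝ) < -ν.real (D p.2) :=
    (hDν.neg.lowerSemicomputable.comp Computable.snd).rePred_lt
      ((primrec_ratCodeNeg.comp primrec_ratCodeHalfPow).to_comp.comp Computable.fst)
  have hlt : ∀ n m, (ratOfCode (ratCodeNeg (ratCodeHalfPow n)) : ℝ) < -ν.real (D m) ↔
      ν.real (D m) < (1 / 2 : ℝ) ^ n := fun n m => by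
    rw [ratOfCode_neg, ratOfCode_halfPow, Rat.cast_neg, neg_lt_neg_iff]
    push_cast
    rfl
  obtain ⟨g, hg, hgD⟩ := hre.exists_computable_choice fun n => by
    obtain ⟨m, hm⟩ := (hlim.eventually_lt_const
      (show (0 : ℝ) < (1 / 2) ^ n by positivity)).exists
    exact ⟨m, (hlt n m).2 hm⟩
  intro hyV
  refine hy (fun n => D (g n))
    ⟨hDopen.comp hg, hDν.comp hg, fun n => ((hlt _ _).1 (hgD n)).le⟩ ?_
  simp only [hD, Set.mem_iInter] at hyV ⊢
  exact fun _ i _ => hyV i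

end Effective

/-! ### The characterization of Schnorr randomness -/

theorem mainTheorem8 {Y : Type*} [MetricSpace Y] [ComputablePolishSpace Y]
    [MeasurableSpace Y] [BorelSpace Y] (ν : MeasureTheory.Measure Y)
    [MeasureTheory.IsProbabilityMeasure ν] (hν : IsComputableMeasure ν) (y : Y) :
    IsSchnorrRandom ν y ↔ ∀ B : Set Y, IsEffectivelySigma02 ν B → ν B = 1 → y ∈ B := by
  constructor
  · rintro hy B ⟨-, C, hC, hCν, rfl⟩ hB
    have hCmeas : ∀ n, MeasurableSet (C n) := fun n =>
      MeasurableSet.compl_iff.1 (hC.isOpen n).measurableSet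
    have hVν : UniformlyComputable fun n => ν.real (C n)ᶜ := by
      simpa only [probReal_compl_eq_one_sub (hCmeas _)] using hCν.one_sub
    have hnull : ν (⋂ n, (C n)ᶜ) = 0 := by
      rw [← Set.compl_iUnion, prob_compl_eq_zero_iff (MeasurableSet.iUnion hCmeas)]
      exact hB
    have hmem := hy.notMem_iInter hν hC hVν hnull
    rwa [← Set.compl_iUnion, Set.notMem_compl_iff] at hmem
  · rintro hy U ⟨hU, hUν, hle⟩
    have hmeas : ∀ n, MeasurableSet (U n) := fun n => (hU.isOpen n).measurableSet
    have hnull : ν (⋂ n, U n) = 0 := by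
      have hzero : ν.real (⋂ n, U n) ≤ 0 :=
        ge_of_tendsto' (tendsto_pow_atTop_nhds_zero_of_lt_one (by norm_num)
          (one_half_lt_one (α := ℝ))) fun n =>
          (measureReal_mono (Set.iInter_subset U n)).trans (hle n)
      exact (measureReal_eq_zero_iff).1 (hzero.antisymm measureReal_nonneg)
    have hB : ν (⋃ n, (U n)ᶜ) = 1 := by
      rw [← Set.compl_iInter, prob_compl_eq_one_iff (MeasurableSet.iInter hmeas)]
      exact hnull
    have hsigma : IsEffectivelySigma02 ν (⋃ n, (U n)ᶜ) := by
      -- `(1, 0, 0)` codes 1, the exact measure of the union.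
      refine ⟨⟨fun _ => (1, 0, 0), Computable.const _, fun k => ?_⟩, fun n => (U n)ᶜ, ?_, ?_, rfl⟩
      · simp [measureReal_def, hB, ratOfCode]
      · simpa only [IsComputableSeqEffClosed, compl_compl] using hU
      · simpa only [probReal_compl_eq_one_sub (hmeas _)] using hUν.one_sub
    have hmem := hy _ hsigma hB
    rwa [← Set.compl_iInter] at hmem
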